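/- Let $G$ be a finite group of order $mn$, where $m,n>1$ and $\gcd(m,n)=1$. For a finite group $Q$ and coprime integers $a,b\ge 1$ let $L_a(Q)=\{x\in Q : x^a=1\}$. Put $D_{a,b}(Q)=1$ if $\gcd(\exp(Q),b)=1$, and otherwise $$D_{a,b}(Q)=\{x\in L_a(Q) : o(xu)\mid b \text{ for every } u\in L_b(Q)\setminus\{1\}\},$$ where $o(\cdot)$ denotes the order of an element. If $|Q|$ divides $ab$, this is a normal subgroup of $Q$. (1) Let $E_1=D_{m,n}(G)$ and let $E_2,E_3,E_4$ be the subgroups of $G$ with $E_1\le E_2\le E_3\le E_4$ determined by $$\frac{E_2}{E_1}=D_{n,m}\!\left(\frac{G}{E_1}\right),\qquad \frac{E_3}{E_2}=D_{m,n}\!\left(\frac{G}{E_2}\right),\qquad \frac{E_4}{E_3}=D_{n,m}\!\left(\frac{G}{E_3}\right).$$ Then $E_3=E_4$. (2) Consequently the $E$-series of $G$ stabilizes after the fourth step. Here the $E$-series with parameters $m,n$ is the sequence $1=E_0(G)\le E_1(G)\le E_2(G)\le\cdots$ in which $E_{k+1}(G)/E_k(G)$ is the whole group $G/E_k(G)$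 if $G/E_k(G)$ is nilpotent, and otherwise is $D_{m,n}(G/E_k(G))$ for even $k$ and $D_{n,m}(G/E_k(G))$ for odd $k$; the assertion is that $E_k(G)=E_4(G)$ for all $k\ge 4$. -/

import Mathlib

namespace CoprimeProducts

/-- The set `L_m(G)` of the elements `x` with `x ^ m = 1`. -/
def L (m : ℕ) (G : Type*) [Group G] : Set G := {x | x ^ m = 1}

/-- The set `D_{m,n}(x)` of the `u ∈ L_n(G)` such that `o(xu)` divides `n`. -/
def DElem {G : Type*} [Group G] (n : ℕ) (x : G) : Set G :=
  {u | u ∈ L n G ∧ orderOf (x * u) ∣ n}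

open scoped Classical in
/-- The set `D_{m,n}(G)`: it is `{1}` if `gcd(exp(G), n) = 1`, and otherwise it is the set of
the `x ∈ L_m(G)` with `L_n(G) \ {1} ⊆ D_{m,n}(x)`. -/
noncomputable def DSet (m n : ℕ) (G : Type*) [Group G] : Set G :=
  if Nat.Coprime (Monoid.exponent G) n then {1}
  else {x | x ∈ L m G ∧ L n G \ {1} ⊆ DElem n x}

/-- `m` and `n` are coprime and `|G|` divides `mn`. This holds for the groups `G` of order `mn`
and for their quotients, and it makes `D_{m,n}(G)` a subgroup. -/
structure Admissible (m n : ℕ) (G : Type*) [Group G] : Prop where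
  coprime : m.Coprime n
  card_dvd : Nat.card G ∣ m * n

theorem Admissible.symm {m n : ℕ} {G : Type*} [Group G] (h : Admissible m n G) :
    Admissible n m G :=
  ⟨h.coprime.symm, by rw [mul_comm]; exact h.card_dvd⟩

theorem Admissible.quotient {m n : ℕ} {G : Type*} [Group G] (h : Admissible m n G)
    (N : Subgroup G) [N.Normal] : Admissible m n (G ⧸ N) :=
  ⟨h.coprime, (Subgroup.card_quotient_dvd_card N).trans h.card_dvd⟩

theorem eq_one_of_pow {m n : ℕ} {G : Type*} [Group G] (h : m.Coprime n) {x : G}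
    (hm : x ^ m = 1) (hn : x ^ n = 1) : x = 1 := by
  have h1 := Nat.dvd_gcd (orderOf_dvd_of_pow_eq_one hm) (orderOf_dvd_of_pow_eq_one hn)
  rw [h.gcd_eq_one, Nat.dvd_one] at h1
  exact orderOf_eq_one_iff.mp h1

/-- `D_{m,n}(G)` as a subgroup; its carrier is the set `DSet m n G`. -/
noncomputable def D {m n : ℕ} {G : Type*} [Group G] (h : Admissible m n G) : Subgroup G where
  carrier := DSet m n G
  one_mem' := by
    unfold DSet
    split_ifs
    · rfl
    · refine ⟨one_pow m, fun u hu => ⟨hu.1, ?_⟩⟩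
      rw [one_mul]
      exact orderOf_dvd_of_pow_eq_one hu.1
  mul_mem' := by
    intro x y hx hy
    unfold DSet at *
    split_ifs at * with hc
    · rw [Set.mem_singleton_iff] at *
      simp [hx, hy]
    · have key : ∀ z ∈ {x | x ∈ L m G ∧ L n G \ {1} ⊆ DElem n x}, ∀ u ∈ L n G \ {1},
          z * u ∈ L n G \ {1} := by
        intro z hz u hu
        refine ⟨orderOf_dvd_iff_pow_eq_one.mp (hz.2 hu).2, fun h1 => hu.2 ?_⟩
        rw [Set.mem_singleton_iff] at h1 ⊢
        have hzu : u = z⁻¹ := (inv_eq_of_mul_eq_one_right h1).symm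
        refine eq_one_of_pow h.coprime ?_ hu.1
        rw [hzu, inv_pow, show z ^ m = 1 from hz.1, inv_one]
      have key2 : ∀ u ∈ L n G \ {1}, x * y * u ∈ L n G \ {1} := fun u hu => by
        rw [mul_assoc]
        exact key x hx _ (key y hy u hu)
      have key3 : ∀ k : ℕ, ∀ u ∈ L n G \ {1}, (x * y) ^ k * u ∈ L n G \ {1} := by
        intro k
        induction k with
        | zero => intro u hu; simpa using hu
        | succ k ih =>
          intro u hu
          rw [pow_succ, mul_assoc]
          exact ih _ (key2 u hu)
      refine ⟨?_, fun u hu => ⟨hu.1, orderOf_dvd_of_pow_eq_one (key2 u hu).1⟩⟩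
      by_contra hne
      have hv : ((x * y) ^ m) ^ n = 1 := by
        rw [← pow_mul]
        exact orderOf_dvd_iff_pow_eq_one.mp ((orderOf_dvd_natCard (x * y)).trans h.card_dvd)
      have hmem : ((x * y) ^ m)⁻¹ ∈ L n G \ {1} := by
        refine ⟨?_, fun h1 => hne (inv_eq_one.mp h1)⟩
        change (((x * y) ^ m)⁻¹) ^ n = 1
        rw [inv_pow, hv, inv_one]
      have h2 := key3 m _ hmem
      rw [mul_inv_cancel] at h2
      exact h2.2 rfl
  inv_mem' := by
    intro x hx
    unfold DSet at *
    split_ifs at * with hc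
    · rw [Set.mem_singleton_iff] at *
      simp [hx]
    · refine ⟨?_, fun u hu => ⟨hu.1, orderOf_dvd_of_pow_eq_one ?_⟩⟩
      · change x⁻¹ ^ m = 1
        rw [inv_pow, show x ^ m = 1 from hx.1, inv_one]
      · have hu' : u⁻¹ ∈ L n G \ {1} := by
          refine ⟨?_, fun h1 => hu.2 (inv_eq_one.mp h1)⟩
          change u⁻¹ ^ n = 1
          rw [inv_pow, show u ^ n = 1 from hu.1, inv_one]
        have h1 : (x * u⁻¹) ^ n = 1 := orderOf_dvd_iff_pow_eq_one.mp (hx.2 hu').2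
        have h2 : x⁻¹ * u = x⁻¹ * (x * u⁻¹)⁻¹ * (x⁻¹)⁻¹ := by group
        rw [h2, conj_pow, inv_pow, h1]
        simp

/-- `D_{m,n}(G)` is normal in `G`. -/
instance D_normal {m n : ℕ} {G : Type*} [Group G] (h : Admissible m n G) : (D h).Normal := by
  constructor
  intro x hx g
  change g * x * g⁻¹ ∈ DSet m n G
  change x ∈ DSet m n G at hx
  unfold DSet at *
  split_ifs at * with hc
  · rw [Set.mem_singleton_iff] at *
    simp [hx]
  · refine ⟨?_, fun u hu => ⟨hu.1, orderOf_dvd_of_pow_eq_one ?_⟩⟩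
    · change (g * x * g⁻¹) ^ m = 1
      rw [conj_pow, show x ^ m = 1 from hx.1]
      simp
    · have hu' : g⁻¹ * u * g ∈ L n G \ {1} := by
        constructor
        · change (g⁻¹ * u * g) ^ n = 1
          have h1 := conj_pow (i := n) (a := g⁻¹) (b := u)
          rw [inv_inv] at h1
          rw [h1, show u ^ n = 1 from hu.1]
          simp
        · intro h1
          apply hu.2
          rw [Set.mem_singleton_iff] at *
          calc u = g * (g⁻¹ * u * g) * g⁻¹ := by group
            _ = 1 := by rw [h1]; simp
      have h1 : (x * (g⁻¹ * u * g)) ^ n = 1 := orderOf_dvd_iff_pow_eq_one.mp (hx.2 hu').2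
      have h2 : g * x * g⁻¹ * u = g * (x * (g⁻¹ * u * g)) * g⁻¹ := by group
      rw [h2, conj_pow, h1]
      simp

/-- The subgroup `E` of `G` that contains `N` and satisfies `E / N = D_{m,n}(G / N)`. -/
noncomputable def DOver {m n : ℕ} {G : Type*} [Group G] (h : Admissible m n G)
    (N : Subgroup G) [N.Normal] : Subgroup G :=
  (D (h.quotient N)).comap (QuotientGroup.mk' N)

instance DOver_normal {m n : ℕ} {G : Type*} [Group G] (h : Admissible m n G)
    (N : Subgroup G) [N.Normal] : (DOver h N).Normal :=
  inferInstanceAs ((D (h.quotient N)).comap (QuotientGroup.mk' N)).Normal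

open scoped Classical in
/-- One step of the `E`-series: the subgroup `E` of `G` that contains `N`, where `E / N` is
`G / N` if this quotient is nilpotent, and `D_{m,n}(G / N)` otherwise. -/
noncomputable def EStep {m n : ℕ} {G : Type*} [Group G] (h : Admissible m n G)
    (N : Subgroup G) [N.Normal] : Subgroup G :=
  if Group.IsNilpotent (G ⧸ N) then ⊤ else DOver h N

instance EStep_normal {m n : ℕ} {G : Type*} [Group G] (h : Admissible m n G)
    (N : Subgroup G) [N.Normal] : (EStep h N).Normal := by
  unfold EStep
  split_ifs <;> infer_instance

open scoped Classical in
/-- The terms of the `E`-series, bundled with their normality. The steps from an even index use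
`D_{m,n}`, those from an odd index use `D_{n,m}`. -/
noncomputable def ESeriesAux {m n : ℕ} {G : Type*} [Group G] (h : Admissible m n G) :
    ℕ → {N : Subgroup G // N.Normal}
  | 0 => ⟨⊥, inferInstance⟩
  | k + 1 =>
    haveI : (ESeriesAux h k).1.Normal := (ESeriesAux h k).2
    if Even k then ⟨EStep h (ESeriesAux h k).1, inferInstance⟩
    else ⟨EStep h.symm (ESeriesAux h k).1, inferInstance⟩

/-- The term `E_k(G)` of the `E`-series of `G` with parameters `m`, `n`. -/
noncomputable def ESeries {m n : ℕ} {G : Type*} [Group G] (h : Admissible m n G) (k : ℕ) :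
    Subgroup G :=
  (ESeriesAux h k).1

end CoprimeProducts

/-!
`D_{m,n}(G)` is the largest normal subgroup of exponent dividing `m` on which every nontrivial
`n`-element of `G` acts fixed-point-freely (`eq_one_of_mem_D_of_commute`, `le_D`), except that it is
trivial when there are no nontrivial `n`-elements. A fixed-point-free action on `N` and on `K / N` is
fixed-point-free on `K`, so taking `D_{m,n}` twice in a row gains nothing (`DOver_DOver`).

Hence, if one of `E₂ / E₁` and `E₃ / E₂` is trivial, then `E₃ = E₄`. Assume that neither is. Then
`M = E₃ / E₂` acts fixed-point-freely on `E₂ / E₁`, after passing to a Schur–Zassenhaus complement,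
and some `n`-element acts fixed-point-freely on `M`. The first action shows that `M` has at most one
involution and that its Sylow subgroups have rank one. The second excludes involutions, so all Sylow
subgroups of `M` are cyclic; the commutator subgroup of `M` is then cyclic, and it is central, because
each element of `M` is a commutator with the `n`-element. So `M` is nilpotent with cyclic Sylow
subgroups, that is, cyclic (`isCyclic_of_ker_fixedPointFree`). In particular, conjugations by elements
of `G / E₂` commute on `M`.

If `E₄ / E₃` were nontrivial too, some `m`-element of `G / E₃` would act fixed-point-freely on it, so
each of its elements would be the image of a commutator of `G / E₂`, which centralizes `M`. But a
power of such a commutator is a nontrivial `n`-element of `G / E₂`, and acts fixed-point-freely on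
`M ≠ 1`. This contradiction is `DOver_DOver_DOver_symm`; together with `DOver_DOver` it shows that
the series is constant from `E₃` on, unless a nilpotent quotient has made a term equal to `G`.
-/

namespace CoprimeProducts

open Subgroup

/-! ### Fixed-point-free actions -/

/-- If `c ≠ 1` has no nontrivial fixed point, then the product of a `c`-orbit, being fixed by `c`,
is trivial. -/
theorem prod_range_pow_smul_eq_one {H V : Type*} [Group H] [CommGroup V] [MulDistribMulAction H V]
    {c : H} (hc : ∀ x : V, c • x = x → x = 1) {q : ℕ} (hq : c ^ q = 1) (x : V) :
    ∏ k ∈ Finset.range q, c ^ k • x = 1 := by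
  apply hc
  rw [Finset.smul_prod']
  have h1 : ∀ k, c • c ^ k • x = c ^ (k + 1) • x := fun k => by rw [smul_smul, pow_succ']
  simp_rw [h1]
  have h2 := Finset.prod_range_succ (fun k => c ^ k • x) q
  have h3 := Finset.prod_range_succ' (fun k => c ^ k • x) q
  rw [h2, hq, pow_zero] at h3
  exact (mul_right_cancel h3).symm

/-- The commutative case of `mem_zpowers_of_fixedPointFree`: multiplying the trivial orbit
products over the subgroups generated by `a ^ j * b` leaves only `x ^ q`. -/
theorem pow_eq_one_of_not_mem_zpowers {H V : Type*} [Group H] [CommGroup V]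
    [MulDistribMulAction H V] (hfpf : ∀ h : H, h ≠ 1 → ∀ x : V, h • x = x → x = 1)
    {q : ℕ} {a b : H} (hab : Commute a b) (ha : orderOf a = q) (hb : b ^ q = 1)
    (hb' : b ∉ zpowers a) (hq : 0 < q) (x : V) : x ^ q = 1 := by
  have haq : a ^ q = 1 := ha ▸ pow_orderOf_eq_one a
  have h1 : ∀ j : ℕ, ∏ k ∈ Finset.range q, (a ^ j * b) ^ k • x = 1 := by
    intro j
    apply prod_range_pow_smul_eq_one
    · apply hfpf
      intro h
      apply hb'
      rw [← inv_eq_of_mul_eq_one_right h]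
      exact inv_mem (pow_mem (mem_zpowers a) j)
    · rw [(hab.pow_left j).mul_pow, hb, ← pow_mul, mul_comm, pow_mul, haq, one_pow, one_mul]
  have h2 : ∏ j ∈ Finset.range q, ∏ k ∈ Finset.range q, (a ^ j * b) ^ k • x = 1 :=
    Finset.prod_eq_one fun j _ => h1 j
  rw [Finset.prod_comm, Finset.prod_eq_single 0] at h2
  · simpa using h2
  · intro k hk hk0
    have h3 : ∀ j : ℕ, (a ^ j * b) ^ k • x = b ^ k • (a ^ k) ^ j • x := fun j => by
      rw [(hab.pow_left j).mul_pow, smul_smul, ← pow_mul, ← pow_mul, mul_comm k j,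
        ((hab.pow_left (j * k)).pow_right k).eq]
    simp_rw [h3]
    rw [← Finset.smul_prod', prod_range_pow_smul_eq_one, smul_one]
    · apply hfpf
      rw [← ha, Finset.mem_range] at hk
      exact pow_ne_one_of_lt_orderOf hk0 hk
    · rw [← pow_mul, mul_comm, pow_mul, haq, one_pow]
  · intro h
    exact absurd (Finset.mem_range.mpr hq) h

/-- The restriction of an action by automorphisms to an invariant subgroup. -/
abbrev restrictAction {A N : Type*} [Group A] [Group N] [MulDistribMulAction A N]
    (Z : Subgroup N) (hZ : ∀ a : A, ∀ z ∈ Z, a • z ∈ Z) : MulDistribMulAction A Z where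
  smul a z := ⟨a • (z : N), hZ a z z.2⟩
  one_smul z := Subtype.ext (one_smul A (z : N))
  mul_smul a b z := Subtype.ext (mul_smul a b (z : N))
  smul_mul a y z := Subtype.ext (smul_mul' a (y : N) (z : N))
  smul_one a := Subtype.ext (smul_one a)

/-- A `q`-group acting on a nontrivial finite group of order prime to `q` normalizes some Sylow
subgroup, whose centre is then a nontrivial invariant commutative subgroup. -/
theorem exists_invariant_commutative {A N : Type*} [Group A] [Group N] [Finite N] [Nontrivial N]
    [MulDistribMulAction A N] {q : ℕ} [Fact q.Prime] (hA : IsPGroup q A)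
    (hq : ¬ q ∣ Nat.card N) :
    ∃ Z : Subgroup N, Z ≠ ⊥ ∧ (∀ y ∈ Z, ∀ z ∈ Z, y * z = z * y) ∧ ∀ a : A, ∀ z ∈ Z, a • z ∈ Z := by
  obtain ⟨r, hr, hrN⟩ := Nat.exists_prime_and_dvd (Finite.one_lt_card (α := N)).ne'
  have : Fact r.Prime := ⟨hr⟩
  have hS : ¬ q ∣ Nat.card (Sylow r N) := fun h =>
    hq (h.trans ((Sylow.card_dvd_index (default : Sylow r N)).trans (index_dvd_card _)))
  obtain ⟨R, hR⟩ := hA.nonempty_fixed_point_of_prime_not_dvd_card (Sylow r N) hS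
  have hRmem : ∀ a : A, ∀ z ∈ R, a • z ∈ R := fun a z hz => by
    have h1 : a • R = R := hR a
    rw [← h1]
    exact Subgroup.smul_mem_pointwise_smul z a (R : Subgroup N) hz
  refine ⟨(R : Subgroup N) ⊓ centralizer (R : Set N), ?_, ?_, ?_⟩
  · have : Nontrivial R := (Subgroup.nontrivial_iff_ne_bot _).mpr (R.ne_bot_of_dvd_card hrN)
    have := R.2.center_nontrivial
    obtain ⟨z, hz⟩ := exists_ne (1 : center R)
    intro h
    apply hz
    have h1 : ((z : R) : N) ∈ (R : Subgroup N) ⊓ centralizer (R : Set N) := by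
      refine ⟨z.1.2, mem_centralizer_iff.mpr fun y hy => ?_⟩
      exact congrArg Subtype.val (mem_center_iff.mp z.2 ⟨y, hy⟩)
    rw [h, mem_bot] at h1
    exact Subtype.ext (Subtype.ext h1)
  · intro y hy z hz
    exact mem_centralizer_iff.mp hz.2 y hy.1
  · intro a z hz
    refine ⟨hRmem a z hz.1, mem_centralizer_iff.mpr fun y hy => ?_⟩
    have h1 := mem_centralizer_iff.mp hz.2 _ (hRmem a⁻¹ y hy)
    have h2 := congrArg (a • ·) h1
    simpa using h2

/-- A group acting fixed-point-freely on a nontrivial finite group of order prime to `q` has no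
subgroup that is elementary abelian of order `q ^ 2`. -/
theorem mem_zpowers_of_fixedPointFree {H N : Type*} [Group H] [Group N] [Finite N] [Nontrivial N]
    [MulDistribMulAction H N] (hfpf : ∀ h : H, h ≠ 1 → ∀ x : N, h • x = x → x = 1)
    {q : ℕ} (hq : q.Prime) (hqN : ¬ q ∣ Nat.card N) {a b : H} (hab : Commute a b)
    (ha : orderOf a = q) (hb : orderOf b = q) : b ∈ zpowers a := by
  by_contra hb'
  have : Fact q.Prime := ⟨hq⟩
  have hpa : IsPGroup q (zpowers a) :=
    IsPGroup.of_card (n := 1) (by rw [Nat.card_zpowers, ha, pow_one])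
  have hpb : IsPGroup q (zpowers b) :=
    IsPGroup.of_card (n := 1) (by rw [Nat.card_zpowers, hb, pow_one])
  have hnorm : zpowers a ≤ normalizer (zpowers b : Set H) := by
    rw [zpowers_le, mem_normalizer_iff]
    intro h
    have h1 : ∀ i : ℤ, a * b ^ i * a⁻¹ = b ^ i := fun i => by
      rw [(hab.zpow_right i).eq, mul_inv_cancel_right]
    constructor
    · rintro ⟨i, rfl⟩
      exact ⟨i, (h1 i).symm⟩
    · rintro ⟨i, hi⟩
      refine ⟨i, ?_⟩
      change b ^ i = a * h * a⁻¹ at hi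
      rw [← h1] at hi
      simpa using hi
  have hA : IsPGroup q (zpowers a ⊔ zpowers b : Subgroup H) :=
    hpa.to_sup_of_normal_right' hpb hnorm
  obtain ⟨Z, hZ, hcomm, hinv⟩ := exists_invariant_commutative (N := N) hA hqN
  let : CommGroup Z :=
    { (inferInstance : Group Z) with mul_comm := fun y z => Subtype.ext (hcomm y y.2 z z.2) }
  let := restrictAction Z hinv
  obtain ⟨⟨z, hzZ⟩, hz⟩ := Subgroup.ne_bot_iff_exists_ne_one.mp hZ
  let a' : (zpowers a ⊔ zpowers b : Subgroup H) := ⟨a, mem_sup_left (mem_zpowers a)⟩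
  let b' : (zpowers a ⊔ zpowers b : Subgroup H) := ⟨b, mem_sup_right (mem_zpowers b)⟩
  have h1 := pow_eq_one_of_not_mem_zpowers (V := Z) (q := q) (a := a') (b := b') ?_ ?_ ?_ ?_ ?_
    hq.pos
  · have h2 : orderOf (⟨z, hzZ⟩ : Z) = q :=
      orderOf_eq_prime (h1 ⟨z, hzZ⟩) (by simpa using hz)
    apply hqN
    rw [← h2, Subgroup.orderOf_mk]
    exact orderOf_dvd_natCard z
  · intro h hh x hx
    exact Subtype.ext (hfpf h (by simpa using hh) x (congrArg Subtype.val hx))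
  · exact Subtype.ext hab
  · rw [Subgroup.orderOf_mk, ha]
  · exact Subtype.ext (hb ▸ pow_orderOf_eq_one b)
  · rintro ⟨i, hi⟩
    exact hb' ⟨i, congrArg Subtype.val hi⟩

/-- In a group acting fixed-point-freely on a nontrivial finite group there is at most one
involution, because every involution acts by inversion. -/
theorem involution_unique_of_fixedPointFree {H N : Type*} [Group H] [Group N] [Finite N]
    [Nontrivial N] [MulDistribMulAction H N]
    (hfpf : ∀ h : H, h ≠ 1 → ∀ x : N, h • x = x → x = 1) {s t : H} (hs : orderOf s = 2)
    (ht : orderOf t = 2) : s = t := by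
  have key : ∀ s : H, orderOf s = 2 → ∀ x : N, s • x = x⁻¹ := by
    intro s hs x
    have h1 : MonoidHom.FixedPointFree (MulDistribMulAction.toMonoidHom N s) := by
      intro x hx
      refine hfpf s ?_ x hx
      rintro rfl
      simp at hs
    have h2 := h1.coe_eq_inv_of_involutive (fun x => by
      have h3 : s * s = 1 := by rw [← sq, ← hs, pow_orderOf_eq_one]
      simp [smul_smul, h3])
    exact congrFun h2 x
  by_contra hst
  obtain ⟨x, hx⟩ := exists_ne (1 : N)
  refine hx (hfpf (s⁻¹ * t) (fun h => hst (inv_mul_eq_one.mp h)) x ?_)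
  rw [mul_smul, key t ht, inv_smul_eq_iff, key s hs]

/-! ### Odd `p`-groups with a unique subgroup of order `p` -/

theorem mul_pow_of_central_commutator {P : Type*} [Group P] {x y c : P} (hc : ∀ g, Commute c g)
    (hyx : y * x = x * y * c) (n : ℕ) :
    y ^ n * x = x * y ^ n * c ^ n ∧ (x * y) ^ n = x ^ n * y ^ n * c ^ n.choose 2 := by
  have h1 : ∀ n : ℕ, y ^ n * x = x * y ^ n * c ^ n := by
    intro n
    induction n with
    | zero => simp
    | succ n ih =>
      calc y ^ (n + 1) * x = y * (y ^ n * x) := by rw [pow_succ', mul_assoc]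
        _ = (y * x) * y ^ n * c ^ n := by rw [ih]; simp only [mul_assoc]
        _ = x * y * (c * y ^ n) * c ^ n := by rw [hyx]; simp only [mul_assoc]
        _ = x * y * (y ^ n * c) * c ^ n := by rw [(hc _).eq]
        _ = x * y ^ (n + 1) * c ^ (n + 1) := by rw [pow_succ', pow_succ']; simp only [mul_assoc]
  refine ⟨h1 n, ?_⟩
  induction n with
  | zero => simp
  | succ n ih =>
    calc (x * y) ^ (n + 1) = x ^ n * y ^ n * (c ^ n.choose 2 * (x * y)) := by
          rw [pow_succ, ih, mul_assoc]
      _ = x ^ n * y ^ n * ((x * y) * c ^ n.choose 2) := by rw [((hc _).pow_left _).eq]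
      _ = x ^ n * (y ^ n * x) * y * c ^ n.choose 2 := by simp only [mul_assoc]
      _ = x ^ n * x * y ^ n * (c ^ n * y) * c ^ n.choose 2 := by rw [h1]; simp only [mul_assoc]
      _ = x ^ n * x * y ^ n * (y * c ^ n) * c ^ n.choose 2 := by rw [((hc _).pow_left _).eq]
      _ = x ^ (n + 1) * y ^ (n + 1) * c ^ (n + 1).choose 2 := by
          rw [Nat.choose_succ_succ' n 1, Nat.choose_one_right, pow_add c, pow_succ x n, pow_succ y n]
          simp only [mul_assoc]

/-- In a minimal counterexample two distinct cyclic subgroups `H` and `K` of index `p` meet in a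
central subgroup of index `> p` that contains all commutators and all `p`-th powers. As `p` is odd,
the `p`-th power map is then a homomorphism, and its kernel has more than `p` elements. -/
theorem isCyclic_of_commute_mem_zpowers {p : ℕ} (hp : p.Prime) (hp2 : p ≠ 2) (k : ℕ) :
    ∀ {P : Type*} [Group P] [Finite P], Nat.card P = p ^ k →
    (∀ a b : P, Commute a b → orderOf a = p → orderOf b = p → b ∈ zpowers a) → IsCyclic P := by
  induction k with
  | zero =>
    intro P _ _ hcard _
    have : Subsingleton P := (Nat.card_eq_one_iff_unique.mp (by simpa using hcard)).1
    infer_instance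
  | succ k ih =>
    intro P _ _ hcard hP
    have : Fact p.Prime := ⟨hp⟩
    have hPp : IsPGroup p P := IsPGroup.of_card hcard
    by_contra hcyc
    have hsub : ∀ H : Subgroup P, Nat.card H = p ^ k → IsCyclic H ∧ H.Normal ∧ H.index = p := by
      intro H hH
      have hidx : H.index = p := by
        have h1 := H.card_mul_index
        rw [hH, hcard, pow_succ] at h1
        exact Nat.eq_of_mul_eq_mul_left (pow_pos hp.pos k) h1
      refine ⟨ih hH fun a b hab ha hb => ?_, ?_, hidx⟩
      · obtain ⟨i, hi⟩ := hP a b (congrArg Subtype.val hab) (by rwa [Subgroup.orderOf_coe])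
          (by rwa [Subgroup.orderOf_coe])
        exact ⟨i, Subtype.ext hi⟩
      · apply normal_of_index_eq_minFac_card
        rw [hidx, hcard, hp.pow_minFac k.succ_ne_zero]
    obtain ⟨H, hH⟩ := Sylow.exists_subgroup_card_pow_prime p (n := k)
      (hcard ▸ pow_dvd_pow p k.le_succ)
    obtain ⟨hHc, hHn, hHi⟩ := hsub H hH
    obtain ⟨x, hx⟩ : ∃ x, x ∉ H := by
      by_contra! h
      rw [(eq_top_iff' H).mpr h, index_top] at hHi
      exact hp.one_lt.ne hHi
    obtain ⟨j, hj⟩ := IsPGroup.iff_card.mp (hPp.to_subgroup (zpowers x))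
    have hjk : j ≤ k := by
      have h1 : Nat.card (zpowers x) ∣ Nat.card P := card_subgroup_dvd_card _
      rw [hj, hcard, Nat.pow_dvd_pow_iff_le_right hp.one_lt] at h1
      rcases h1.lt_or_eq with h2 | h2
      · omega
      · exfalso
        refine hcyc (isCyclic_iff_exists_zpowers_eq_top.mpr ⟨x, ?_⟩)
        exact eq_top_of_card_eq _ (by rw [hj, hcard, h2])
    obtain ⟨K, hK, hxK⟩ := Sylow.exists_subgroup_card_pow_prime_le p (n := j) (m := k)
      (hcard ▸ pow_dvd_pow p k.le_succ) (zpowers x) hj hjk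
    obtain ⟨hKc, hKn, hKi⟩ := hsub K hK
    have hxK' : x ∈ K := hxK (mem_zpowers x)
    have hHK : H < H ⊔ K := lt_of_le_of_ne le_sup_left fun h => hx (h ▸ mem_sup_right hxK')
    have htop : H ⊔ K = ⊤ := by
      rw [← index_eq_one]
      rcases hp.eq_one_or_self_of_dvd _ (hHi ▸ index_dvd_of_le (le_sup_left (a := H) (b := K)))
        with h | h
      · exact h
      · exact absurd (h.trans hHi.symm) (index_strictAnti hHK).ne
    have hcent : ∀ w ∈ H ⊓ K, ∀ g, Commute w g := by
      intro w hw g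
      have h1 : H ⊔ K ≤ centralizer {w} := by
        have hcl : ∀ L : Subgroup P, IsCyclic L → w ∈ L → L ≤ centralizer {w} := by
          intro L hL hwL g hg
          let := hL.commGroup
          rw [mem_centralizer_singleton_iff]
          exact congrArg Subtype.val (mul_comm (⟨g, hg⟩ : L) ⟨w, hwL⟩)
        exact sup_le (hcl H hHc hw.1) (hcl K hKc hw.2)
      rw [htop] at h1
      exact (mem_centralizer_singleton_iff.mp (h1 (mem_top g))).symm
    have hquot : ∀ L : Subgroup P, L.Normal → L.index = p →
        (∀ g, g ^ p ∈ L) ∧ ∀ g h : P, (g * h)⁻¹ * (h * g) ∈ L := by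
      intro L _ hL
      have hc : Nat.card (P ⧸ L) = p := hL
      refine ⟨fun g => ?_, fun g h => ?_⟩
      · rw [← hL]; exact L.pow_index_mem g
      · have := isCyclic_of_prime_card hc
        let := IsCyclic.commGroup (α := P ⧸ L)
        rw [← QuotientGroup.eq]
        exact mul_comm (g : P ⧸ L) h
    have hpow : ∀ g, g ^ p ∈ H ⊓ K := fun g => ⟨(hquot H hHn hHi).1 g, (hquot K hKn hKi).1 g⟩
    have hmul : ∀ g h : P, (g * h) ^ p = g ^ p * h ^ p := by
      intro g h
      have hc := hcent _ ⟨(hquot H hHn hHi).2 g h, (hquot K hKn hKi).2 g h⟩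
      obtain ⟨h1, h2⟩ := mul_pow_of_central_commutator hc (mul_inv_cancel_left _ _).symm p
      have h3 : ((g * h)⁻¹ * (h * g)) ^ p = 1 := by
        rw [(hcent _ (hpow h) g).eq] at h1
        exact (left_eq_mul.mp h1)
      obtain ⟨d, hd⟩ := hp.dvd_choose_self two_ne_zero (lt_of_le_of_ne hp.two_le hp2.symm)
      rw [h2, hd, pow_mul, h3, one_pow, mul_one]
    let f : P →* P := { toFun := fun g => g ^ p, map_one' := one_pow p, map_mul' := hmul }
    have : Nontrivial P := ⟨x, 1, fun h => hx (h ▸ one_mem H)⟩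
    have := hPp.center_nontrivial
    obtain ⟨z, hz⟩ := exists_prime_orderOf_dvd_card' (G := center P) p
      ((hPp.to_subgroup _).card_eq_or_dvd.resolve_left Finite.one_lt_card.ne')
    rw [← Subgroup.orderOf_coe] at hz
    have hker : f.ker ≤ zpowers (z : P) := by
      intro g hg
      rcases eq_or_ne g 1 with rfl | hg1
      · exact one_mem _
      · exact hP z g (mem_center_iff.mp z.2 g).symm hz (orderOf_eq_prime hg hg1)
    have hkcard : Nat.card f.ker ≤ p := by
      have := card_le_of_le hker
      rwa [Nat.card_zpowers, hz] at this
    have hrange : f.range ≤ H ⊓ K := by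
      rintro _ ⟨g, rfl⟩
      exact hpow g
    have hlt : H ⊓ K < H := lt_of_le_of_ne inf_le_left fun h => by
      have h1 : H ≤ K := inf_eq_left.mp h
      have h2 : H = K := eq_of_le_of_card_ge h1 (by rw [hH, hK])
      exact hx (h2 ▸ hxK')
    have h1 : Nat.card f.range < p ^ k :=
      (card_le_of_le hrange).trans_lt (hH ▸ Set.ncard_lt_ncard hlt (Set.toFinite _))
    have h2 : Nat.card f.ker * Nat.card f.range = p * p ^ k := by
      rw [← index_ker, card_mul_index, hcard, pow_succ']
    have h3 : Nat.card f.ker * Nat.card f.range < p * p ^ k :=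
      Nat.mul_lt_mul_of_le_of_lt hkcard h1 hp.pos
    omega

/-! ### Fixed-point-free actions by a group with a fixed-point-free automorphism -/

/-- Endomorphisms of a cyclic group commute. -/
theorem map_comm_of_isCyclic {G : Type*} [Group G] {C : Subgroup G} [IsCyclic C] {σ τ : G →* G}
    (hσ : ∀ c ∈ C, σ c ∈ C) (hτ : ∀ c ∈ C, τ c ∈ C) {c : G} (hc : c ∈ C) :
    σ (τ c) = τ (σ c) := by
  obtain ⟨⟨g, hg⟩, hgen⟩ := IsCyclic.exists_generator (α := C)
  have hpow : ∀ x ∈ C, ∃ i : ℤ, g ^ i = x := fun x hx => by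
    obtain ⟨i, hi⟩ := hgen ⟨x, hx⟩
    exact ⟨i, congrArg Subtype.val hi⟩
  obtain ⟨k, rfl⟩ := hpow c hc
  obtain ⟨i, hi⟩ := hpow _ (hσ g hg)
  obtain ⟨j, hj⟩ := hpow _ (hτ g hg)
  simp only [map_zpow, ← hi, ← hj]
  rw [zpow_comm g i j]

/-- Every element of a finite Z-group with a fixed-point-free automorphism `σ` has the form
`y / σ y`, so it centralizes the cyclic commutator subgroup, on which all automorphisms commute.
The group is therefore nilpotent. -/
theorem isCyclic_of_isZGroup_of_fixedPointFree {H : Type*} [Group H] [Finite H] [IsZGroup H]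
    {σ : H ≃* H} (hσ : MonoidHom.FixedPointFree σ) : IsCyclic H := by
  have := IsZGroup.isCyclic_commutator H
  have hchar : ∀ τ : H ≃* H, ∀ z ∈ commutator H, τ z ∈ commutator H := fun τ z hz =>
    characteristic_iff_map_le.mp inferInstance τ (mem_map_of_mem τ.toMonoidHom hz)
  have hcent : commutator H ≤ center H := by
    intro c hc
    rw [mem_center_iff]
    intro x
    obtain ⟨y, rfl⟩ := hσ.commutatorMap_surjective x
    -- conjugation by `y` and by `σ y` agree on the commutator subgroup
    have key : σ (y * (y⁻¹ * σ.symm c * y) * y⁻¹) = y * σ (y⁻¹ * σ.symm c * y) * y⁻¹ :=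
      map_comm_of_isCyclic (C := commutator H) (σ := σ.toMonoidHom)
        (τ := (MulAut.conj y).toMonoidHom) (hchar σ) (hchar (MulAut.conj y))
        (hchar (MulAut.conj y).symm _ (hchar σ.symm c hc))
    simp only [map_mul, map_inv, MulEquiv.apply_symm_apply] at key
    rw [MonoidHom.commutatorMap_apply, div_eq_mul_inv]
    have h2 : c = y * (σ y)⁻¹ * c * (y * (σ y)⁻¹)⁻¹ := by
      calc c = σ y * ((σ y)⁻¹ * c * σ y) * (σ y)⁻¹ := by group
        _ = _ := key
        _ = _ := by group
    nth_rewrite 2 [h2]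
    group
  have : Group.IsNilpotent H :=
    Subgroup.isNilpotent_of_ker_le_center (Abelianization.of (G := H))
      (by rwa [Abelianization.ker_of])
  infer_instance

/-- A fixed-point-free automorphism cannot fix a unique involution, so the acting group has odd
order, and its Sylow subgroups are cyclic because they have rank one. -/
theorem isCyclic_of_fixedPointFree {H N : Type*} [Group H] [Finite H] [Group N] [Finite N]
    [Nontrivial N] [MulDistribMulAction H N]
    (hfpf : ∀ h : H, h ≠ 1 → ∀ x : N, h • x = x → x = 1)
    (hcop : (Nat.card N).Coprime (Nat.card H)) {σ : H ≃* H} (hσ : MonoidHom.FixedPointFree σ) :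
    IsCyclic H := by
  have hodd : ¬ 2 ∣ Nat.card H := by
    intro h
    obtain ⟨s, hs⟩ := exists_prime_orderOf_dvd_card' (G := H) 2 h
    have h1 : σ s = s := involution_unique_of_fixedPointFree hfpf (by rwa [σ.orderOf_eq]) hs
    rw [hσ s h1, orderOf_one] at hs
    omega
  have : IsZGroup H := by
    rw [isZGroup_iff]
    intro p hp P
    have : Fact p.Prime := ⟨hp⟩
    obtain ⟨k, hk⟩ := IsPGroup.iff_card.mp P.isPGroup'
    by_cases hpH : p ∣ Nat.card H
    · refine isCyclic_of_commute_mem_zpowers hp (fun h => hodd (h ▸ hpH)) k hk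
        fun a b hab ha hb => ?_
      have hpN : ¬ p ∣ Nat.card N := fun h =>
        hp.one_lt.ne' (Nat.dvd_one.mp (hcop.gcd_eq_one ▸ Nat.dvd_gcd h hpH))
      obtain ⟨i, hi⟩ := mem_zpowers_of_fixedPointFree hfpf hp hpN (a := (a : H)) (b := (b : H))
        (congrArg Subtype.val hab) (by rwa [Subgroup.orderOf_coe]) (by rwa [Subgroup.orderOf_coe])
      exact ⟨i, Subtype.ext hi⟩
    · have : Subsingleton (P : Subgroup H) := by
        rcases P.isPGroup'.card_eq_or_dvd with h | h
        · exact (Nat.card_eq_one_iff_unique.mp h).1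
        · exact absurd (h.trans (card_subgroup_dvd_card _)) hpH
      infer_instance
  exact isCyclic_of_isZGroup_of_fixedPointFree hσ

/-- The version of `isCyclic_of_fixedPointFree` for a quotient `M` of `X` by a normal subgroup of
coprime order: by the Schur–Zassenhaus theorem `M` is isomorphic to a complement. -/
theorem isCyclic_of_ker_fixedPointFree {X M : Type*} [Group X] [Finite X] [Group M] {g : X →* M}
    (hg : Function.Surjective g) (hker : g.ker ≠ ⊥)
    (hcop : (Nat.card g.ker).Coprime (Nat.card M))
    (hfpf : ∀ x : X, x ≠ 1 → x ^ Nat.card M = 1 → ∀ y ∈ g.ker, Commute x y → y = 1)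
    {σ : M ≃* M} (hσ : MonoidHom.FixedPointFree σ) : IsCyclic M := by
  have hidx : g.ker.index = Nat.card M := by
    rw [index_ker, MonoidHom.range_eq_top.mpr hg, card_top]
  obtain ⟨H, hH⟩ := exists_right_complement'_of_coprime (N := g.ker) (by rwa [hidx])
  have hcard : Nat.card H = Nat.card M := by
    have h1 := hH.card_mul_card
    rw [← g.ker.card_mul_index, hidx] at h1
    exact Nat.eq_of_mul_eq_mul_left Nat.card_pos h1
  have hinj : Function.Injective (g.comp H.subtype) := by
    rw [injective_iff_map_eq_one]
    intro h hh
    have h1 : (h : X) ∈ g.ker ⊓ H := ⟨hh, h.2⟩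
    rw [hH.disjoint.eq_bot, mem_bot] at h1
    exact Subtype.ext h1
  have : Finite M := Finite.of_surjective g hg
  have hbij : Function.Bijective (g.comp H.subtype) := by
    rw [Nat.bijective_iff_injective_and_card]
    exact ⟨hinj, hcard⟩
  let e : H ≃* M := MulEquiv.ofBijective (g.comp H.subtype) hbij
  have hnt : Nontrivial g.ker := (nontrivial_iff_ne_bot _).mpr hker
  let : MulDistribMulAction H g.ker :=
    MulDistribMulAction.compHom g.ker ((MulAut.conjNormal (H := g.ker)).comp H.subtype)
  have hsmul : ∀ (h : H) (y : g.ker), ((h • y : g.ker) : X) = h * y * (h : X)⁻¹ := fun h y =>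
    MulAut.conjNormal_apply (h : X) y
  have : IsCyclic H := by
    refine isCyclic_of_fixedPointFree (N := g.ker) (σ := (e.trans σ).trans e.symm) ?_
      (hcard ▸ hcop) ?_
    · intro h hh y hy
      refine Subtype.ext (hfpf h (fun h1 => hh (Subtype.ext h1)) ?_ y y.2 ?_)
      · rw [← hcard, ← Subgroup.coe_pow, pow_card_eq_one', Subgroup.coe_one]
      · have h1 := congrArg Subtype.val hy
        rw [hsmul] at h1
        exact mul_inv_eq_iff_eq_mul.mp h1
    · intro h hh
      have h1 : σ (e h) = e h := by simpa [MulEquiv.symm_apply_eq] using hh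
      simpa using hσ _ h1
  exact isCyclic_of_surjective e e.surjective

/-! ### `D_{m,n}(G)` as the largest normal fixed-point-free subgroup -/

theorem coprime_card_of_pow_eq_one {K : Type*} [Group K] [Finite K] {m n : ℕ}
    (hK : ∀ x : K, x ^ n = 1) (hmn : n.Coprime m) : (Nat.card K).Coprime m := by
  refine Nat.coprime_of_dvd fun p hp h1 h2 => ?_
  have : Fact p.Prime := ⟨hp⟩
  obtain ⟨x, hx⟩ := exists_prime_orderOf_dvd_card' (G := K) p h1
  have h3 : p ∣ n := hx ▸ orderOf_dvd_of_pow_eq_one (hK x)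
  exact hp.one_lt.ne' (Nat.dvd_one.mp (hmn.gcd_eq_one ▸ Nat.dvd_gcd h3 h2))

/-- Every element of a finite normal subgroup on which `u` acts fixed-point-freely is a
commutator with `u`. -/
theorem exists_commutator_eq {Q : Type*} [Group Q] {N : Subgroup Q} [N.Normal] [Finite N] {u : Q}
    (hu : ∀ x ∈ N, Commute x u → x = 1) {x : Q} (hx : x ∈ N) :
    ∃ y ∈ N, x = y * u * y⁻¹ * u⁻¹ := by
  have h1 : MonoidHom.FixedPointFree (MulAut.conjNormal u : MulAut N) := by
    intro z hz
    refine Subtype.ext (hu z z.2 ?_)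
    have h2 := congrArg Subtype.val hz
    rw [MulAut.conjNormal_apply] at h2
    exact (mul_inv_eq_iff_eq_mul.mp h2).symm
  obtain ⟨y, hy⟩ := h1.commutatorMap_surjective ⟨x, hx⟩
  refine ⟨y, y.2, ?_⟩
  have h2 := congrArg Subtype.val hy
  rw [MonoidHom.commutatorMap_apply, Subgroup.coe_div, MulAut.conjNormal_apply] at h2
  change _ = x at h2
  rw [← h2, div_eq_mul_inv]
  group

variable {m n : ℕ} {G : Type*} [Group G]

theorem exists_pow_eq_one_of_not_coprime [Finite G]
    (hc : ¬ Nat.Coprime (Monoid.exponent G) n) : ∃ u : G, u ≠ 1 ∧ u ^ n = 1 := by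
  obtain ⟨p, hp, h1, h2⟩ := Nat.Prime.not_coprime_iff_dvd.mp hc
  have : Fact p.Prime := ⟨hp⟩
  obtain ⟨u, hu⟩ := exists_prime_orderOf_dvd_card' (G := G) p
    (h1.trans Group.exponent_dvd_nat_card)
  refine ⟨u, ?_, orderOf_dvd_iff_pow_eq_one.mp (hu ▸ h2)⟩
  rintro rfl
  rw [orderOf_one] at hu
  exact hp.one_lt.ne hu

theorem D_eq_bot_of_coprime (h : Admissible m n G) (hc : Nat.Coprime (Monoid.exponent G) n) :
    D h = ⊥ := by
  ext x
  change x ∈ DSet m n G ↔ _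
  rw [DSet, if_pos hc, Set.mem_singleton_iff, mem_bot]

theorem pow_eq_one_of_mem_D {h : Admissible m n G} {x : G} (hx : x ∈ D h) : x ^ m = 1 := by
  change x ∈ DSet m n G at hx
  unfold DSet at hx
  split_ifs at hx
  · rw [Set.mem_singleton_iff.mp hx, one_pow]
  · exact hx.1

theorem eq_one_of_mem_D_of_commute {h : Admissible m n G} {x u : G} (hx : x ∈ D h) (hu : u ≠ 1)
    (hun : u ^ n = 1) (hxu : Commute x u) : x = 1 := by
  have hxm := pow_eq_one_of_mem_D hx
  change x ∈ DSet m n G at hx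
  unfold DSet at hx
  split_ifs at hx
  · exact hx
  · have h1 : (x * u) ^ n = 1 := orderOf_dvd_iff_pow_eq_one.mp (hx.2 ⟨hun, hu⟩).2
    rw [hxu.mul_pow, hun, mul_one] at h1
    exact eq_one_of_pow h.coprime hxm h1

/-- If `u` acts fixed-point-freely on `N`, then all elements of the coset `N u` are conjugate to
`u`, so they have the same order as `u`. -/
theorem le_D [Finite G] (h : Admissible m n G) (hc : ¬ Nat.Coprime (Monoid.exponent G) n)
    {N : Subgroup G} [N.Normal] (hm : ∀ x ∈ N, x ^ m = 1)
    (hN : ∀ x ∈ N, ∀ u, u ≠ 1 → u ^ n = 1 → Commute x u → x = 1) : N ≤ D h := by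
  intro x hx
  change x ∈ DSet m n G
  rw [DSet, if_neg hc]
  refine ⟨hm x hx, fun u hu => ⟨hu.1, orderOf_dvd_of_pow_eq_one ?_⟩⟩
  obtain ⟨y, -, rfl⟩ := exists_commutator_eq (fun z hz => hN z hz u hu.2 hu.1) hx
  rw [inv_mul_cancel_right, conj_pow, show u ^ n = 1 from hu.1, mul_one, mul_inv_cancel]

theorem comap_D_mulEquiv {G' : Type*} [Group G'] (h : Admissible m n G) (h' : Admissible m n G')
    (e : G ≃* G') : (D h').comap e.toMonoidHom = D h := by
  ext x
  change e x ∈ DSet m n G' ↔ x ∈ DSet m n G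
  unfold DSet
  rw [Monoid.exponent_eq_of_mulEquiv e]
  split_ifs
  · simp
  · refine and_congr ?_ ?_
    · change e x ^ m = 1 ↔ x ^ m = 1
      rw [← map_pow, map_eq_one_iff e e.injective]
    · have hL : ∀ u : G, e u ∈ L n G' \ {1} ↔ u ∈ L n G \ {1} := fun u => by
        refine and_congr ?_ (by simp)
        change e u ^ n = 1 ↔ u ^ n = 1
        rw [← map_pow, map_eq_one_iff e e.injective]
      constructor
      · intro H u hu
        refine ⟨hu.1, ?_⟩
        have h1 := (H ((hL u).mpr hu)).2
        rwa [← map_mul, e.orderOf_eq] at h1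
      · intro H u hu
        obtain ⟨u, rfl⟩ := e.surjective u
        refine ⟨hu.1, ?_⟩
        rw [← map_mul, e.orderOf_eq]
        exact (H ((hL u).mp hu)).2

/-! ### The operator `N ↦ DOver h N` -/

theorem DOver_congr (h : Admissible m n G) {N N' : Subgroup G} [N.Normal] [N'.Normal]
    (hN : N = N') : DOver h N = DOver h N' := by
  subst hN
  rfl

theorem DOver_bot (h : Admissible m n G) : DOver h (⊥ : Subgroup G) = D h :=
  comap_D_mulEquiv h (h.quotient ⊥) QuotientGroup.quotientBot.symm

theorem le_DOver (h : Admissible m n G) (N : Subgroup G) [N.Normal] : N ≤ DOver h N := by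
  intro x hx
  rw [DOver, mem_comap, QuotientGroup.mk'_apply, (QuotientGroup.eq_one_iff x).mpr hx]
  exact one_mem _

theorem DOver_eq_of_D_eq_bot (h : Admissible m n G) (N : Subgroup G) [N.Normal]
    (hD : D (h.quotient N) = ⊥) : DOver h N = N := by
  rw [DOver, hD, MonoidHom.comap_bot, QuotientGroup.ker_mk']

theorem pow_mem_of_mem_DOver {h : Admissible m n G} {N : Subgroup G} [N.Normal] {x : G}
    (hx : x ∈ DOver h N) : x ^ m ∈ N := by
  have h1 := pow_eq_one_of_mem_D (mem_comap.mp hx)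
  rwa [QuotientGroup.mk'_apply, ← QuotientGroup.mk_pow, QuotientGroup.eq_one_iff] at h1

theorem mem_of_mem_DOver_of_commute {h : Admissible m n G} {N : Subgroup G} [N.Normal] {x u : G}
    (hx : x ∈ DOver h N) (hu : u ∉ N) (hun : u ^ n ∈ N)
    (hxu : Commute (x : G ⧸ N) (u : G ⧸ N)) : x ∈ N := by
  rw [← QuotientGroup.eq_one_iff]
  refine eq_one_of_mem_D_of_commute (mem_comap.mp hx) ?_ ?_ hxu
  · rwa [ne_eq, QuotientGroup.eq_one_iff]
  · rwa [← QuotientGroup.mk_pow, QuotientGroup.eq_one_iff]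

theorem not_coprime_of_DOver_ne (h : Admissible m n G) (N : Subgroup G) [N.Normal]
    (hN : DOver h N ≠ N) : ¬ Nat.Coprime (Monoid.exponent (G ⧸ N)) n := fun hc =>
  hN (DOver_eq_of_D_eq_bot h N (D_eq_bot_of_coprime _ hc))

/-- An element that acts fixed-point-freely on `N` and on `K / N` also does so on `K`; hence by
maximality `D_{m,n}(G / D_{m,n}(G)) = 1`. -/
theorem DOver_DOver [Finite G] (h : Admissible m n G) (N : Subgroup G) [N.Normal] :
    DOver h (DOver h N) = DOver h N := by
  by_cases hc : Nat.Coprime (Monoid.exponent (G ⧸ N)) n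
  · have h1 := DOver_eq_of_D_eq_bot h N (D_eq_bot_of_coprime _ hc)
    exact DOver_congr h h1
  · refine le_antisymm ?_ (le_DOver h _)
    have hpow : ∀ x ∈ DOver h (DOver h N), x ^ m ∈ N := by
      intro x hx
      have h1 : (x ^ m) ^ m ∈ N := pow_mem_of_mem_DOver (pow_mem_of_mem_DOver hx)
      have h2 : (x ^ m) ^ n ∈ N := by
        rw [← QuotientGroup.eq_one_iff, ← pow_mul, QuotientGroup.mk_pow]
        exact orderOf_dvd_iff_pow_eq_one.mp
          ((_root_.orderOf_dvd_natCard _).trans (h.quotient N).card_dvd)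
      rw [← QuotientGroup.eq_one_iff] at h1 h2 ⊢
      exact eq_one_of_pow h.coprime h1 h2
    refine (map_le_iff_le_comap (f := QuotientGroup.mk' N)).mp ?_
    have : (map (QuotientGroup.mk' N) (DOver h (DOver h N))).Normal :=
      Normal.map inferInstance _ (QuotientGroup.mk'_surjective N)
    refine le_D _ hc ?_ ?_
    · rintro _ ⟨x, hx, rfl⟩
      rw [QuotientGroup.mk'_apply, ← QuotientGroup.mk_pow, QuotientGroup.eq_one_iff]
      exact hpow x hx
    · rintro _ ⟨x, hx, rfl⟩ u hu hun hxu
      obtain ⟨u, rfl⟩ := QuotientGroup.mk_surjective u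
      rw [ne_eq, QuotientGroup.eq_one_iff] at hu
      rw [← QuotientGroup.mk_pow, QuotientGroup.eq_one_iff] at hun
      rw [QuotientGroup.mk'_apply, QuotientGroup.eq_one_iff]
      have hle := le_DOver h N
      have huE : u ∉ DOver h N := fun h1 => hu <| by
        have h2 := pow_mem_of_mem_DOver h1
        rw [← QuotientGroup.eq_one_iff] at h2 hun ⊢
        exact eq_one_of_pow h.coprime h2 hun
      refine mem_of_mem_DOver_of_commute (mem_of_mem_DOver_of_commute hx huE (hle hun) ?_) hu hun
        hxu
      exact hxu.map (QuotientGroup.map N (DOver h N) (MonoidHom.id G) hle)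

/-! ### The series stabilizes -/

/-- Conjugations by two elements commute on a cyclic normal subgroup, so the commutator of the two
elements centralizes it. -/
theorem commute_commutator_of_isCyclic {Q : Type*} [Group Q] {C : Subgroup Q} [C.Normal]
    [IsCyclic C] (y t : Q) {c : Q} (hc : c ∈ C) : Commute c (y * t * y⁻¹ * t⁻¹) := by
  have hinv : ∀ z : Q, ∀ c ∈ C, (MulAut.conj z).toMonoidHom c ∈ C := fun z c hc =>
    Normal.conj_mem inferInstance c hc z
  have hd : (t * y)⁻¹ * c * (t * y) ∈ C := by
    simpa using Normal.conj_mem (H := C) inferInstance c hc (t * y)⁻¹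
  have key : t * (y * ((t * y)⁻¹ * c * (t * y)) * y⁻¹) * t⁻¹ =
      y * (t * ((t * y)⁻¹ * c * (t * y)) * t⁻¹) * y⁻¹ :=
    map_comm_of_isCyclic (hinv t) (hinv y) hd
  have h1 : c = y * t * y⁻¹ * t⁻¹ * c * (y * t * y⁻¹ * t⁻¹)⁻¹ := by
    calc c = t * (y * ((t * y)⁻¹ * c * (t * y)) * y⁻¹) * t⁻¹ := by group
      _ = _ := key
      _ = _ := by group
  exact eq_mul_inv_iff_mul_eq.mp h1

/-- The kernel of `G / N → G / E`, where `E = DOver h.symm N`, is acted on fixed-point-freely by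
the nontrivial `m`-elements of `G / N`, so `isCyclic_of_ker_fixedPointFree` applies to the preimage
of `D_{m,n}(G / E)`. -/
theorem isCyclic_D_quotient [Finite G] (h : Admissible m n G) (N : Subgroup G) [N.Normal]
    (hN : DOver h.symm N ≠ N) (hE : DOver h (DOver h.symm N) ≠ DOver h.symm N) :
    IsCyclic (D (h.quotient (DOver h.symm N))) := by
  have hle := le_DOver h.symm N
  let f : G ⧸ N →* G ⧸ DOver h.symm N :=
    QuotientGroup.map N (DOver h.symm N) (MonoidHom.id G) hle
  have hf : Function.Surjective f := by
    intro x
    obtain ⟨x, rfl⟩ := QuotientGroup.mk_surjective x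
    exact ⟨(x : G ⧸ N), rfl⟩
  have hfker : ∀ y : G ⧸ N, f y = 1 → y ∈ D (h.symm.quotient N) := by
    intro y hy
    obtain ⟨y, rfl⟩ := QuotientGroup.mk_surjective y
    exact (QuotientGroup.eq_one_iff y).mp hy
  set M := D (h.quotient (DOver h.symm N)) with hM
  have hMn : (Nat.card M).Coprime n := coprime_card_of_pow_eq_one
    (fun x => Subtype.ext (pow_eq_one_of_mem_D x.2)) h.coprime
  have hkerpow : ∀ y ∈ (f.subgroupComap M).ker, (y : G ⧸ N) ∈ D (h.symm.quotient N) :=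
    fun y hy => hfker y (congrArg Subtype.val hy)
  obtain ⟨u, hu, hun⟩ := exists_pow_eq_one_of_not_coprime (not_coprime_of_DOver_ne h _ hE)
  refine isCyclic_of_ker_fixedPointFree (g := f.subgroupComap M)
    (f.subgroupComap_surjective_of_surjective M hf) ?_ ?_ ?_ (σ := MulAut.conjNormal u) ?_
  · intro hbot
    obtain ⟨y, hy, hyN⟩ := SetLike.exists_of_lt (lt_of_le_of_ne hle hN.symm)
    have hfy : f (y : G ⧸ N) = 1 := (QuotientGroup.eq_one_iff y).mpr hy
    have h1 : (⟨y, by rw [mem_comap, hfy]; exact one_mem _⟩ : M.comap f) ∈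
        (f.subgroupComap M).ker := Subtype.ext hfy
    rw [hbot, mem_bot] at h1
    exact hyN ((QuotientGroup.eq_one_iff y).mp (congrArg Subtype.val h1))
  · exact coprime_card_of_pow_eq_one (n := n)
      (fun y => Subtype.ext (Subtype.ext (pow_eq_one_of_mem_D (hkerpow y y.2)))) hMn.symm
  · intro x hx hxM y hy hxy
    refine Subtype.ext (eq_one_of_mem_D_of_commute (hkerpow y hy) (u := (x : G ⧸ N))
      (fun h1 => hx (Subtype.ext h1)) ?_ (congrArg Subtype.val hxy).symm)
    have h1 : orderOf (x : G ⧸ N) ∣ Nat.card M :=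
      orderOf_dvd_of_pow_eq_one (congrArg Subtype.val hxM)
    have h2 : orderOf (x : G ⧸ N) ∣ m * n :=
      (_root_.orderOf_dvd_natCard _).trans (h.quotient N).card_dvd
    exact orderOf_dvd_iff_pow_eq_one.mp ((hMn.coprime_dvd_left h1).dvd_of_dvd_mul_right h2)
  · intro z hz
    refine Subtype.ext (eq_one_of_mem_D_of_commute z.2 hu hun ?_)
    have h1 := congrArg Subtype.val hz
    rw [MulAut.conjNormal_apply] at h1
    exact (mul_inv_eq_iff_eq_mul.mp h1).symm

/-- With `E = DOver h.symm N`, `F = DOver h E` and `P = DOver h.symm F`: if all three steps were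
proper, then `P / F` would consist of commutators, which centralize the cyclic group `F / E`,
although the `n`-elements of `G / E` act fixed-point-freely on it. -/
theorem DOver_DOver_DOver_symm [Finite G] (h : Admissible m n G) (N : Subgroup G) [N.Normal]
    (hN : DOver h N = N) :
    DOver h.symm (DOver h (DOver h.symm N)) = DOver h (DOver h.symm N) := by
  by_cases h2 : DOver h (DOver h.symm N) = DOver h.symm N
  · rw [DOver_congr h.symm h2, DOver_DOver, h2]
  have h1 : DOver h.symm N ≠ N := fun h1 => h2 (by rw [DOver_congr h h1, hN, h1])
  by_contra h3
  have hcyc := isCyclic_D_quotient h N h1 h2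
  set E := DOver h.symm N with hE
  set F := DOver h E with hF
  obtain ⟨t, ht, htm⟩ := exists_pow_eq_one_of_not_coprime (not_coprime_of_DOver_ne h.symm F h3)
  obtain ⟨p, hpP, hpF⟩ := SetLike.exists_of_lt (lt_of_le_of_ne (le_DOver h.symm F) (Ne.symm h3))
  obtain ⟨y, -, hy⟩ := exists_commutator_eq (N := D (h.symm.quotient F)) (u := t)
    (fun x hx hxt => eq_one_of_mem_D_of_commute hx ht htm hxt) (x := (p : G ⧸ F)) hpP
  obtain ⟨y, rfl⟩ := QuotientGroup.mk_surjective y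
  obtain ⟨t, rfl⟩ := QuotientGroup.mk_surjective t
  -- the representative of `p` that is a commutator in `G`
  set w := y * t * y⁻¹ * t⁻¹ with hw
  have hwp : (w : G ⧸ F) = (p : G ⧸ F) := hy.symm
  have hwF : w ∉ F := by
    rwa [← QuotientGroup.eq_one_iff, hwp, QuotientGroup.eq_one_iff]
  have hwn : w ^ n ∈ F := by
    rw [← QuotientGroup.eq_one_iff, QuotientGroup.mk_pow, hwp]
    exact pow_eq_one_of_mem_D (h := h.symm.quotient F) hpP
  have hv : (w ^ m) ^ n ∈ E := by
    rw [← pow_mul, mul_comm, pow_mul]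
    exact pow_mem_of_mem_DOver hwn
  have hvE : w ^ m ∉ E := fun h4 => hwF <| by
    have h5 := le_DOver h E h4
    rw [← QuotientGroup.eq_one_iff] at hwn h5 ⊢
    exact eq_one_of_pow h.coprime h5 hwn
  apply h2
  refine le_antisymm (fun x hx => ?_) (le_DOver h E)
  have hcomm : Commute (x : G ⧸ E) (w : G ⧸ E) :=
    commute_commutator_of_isCyclic (C := D (h.quotient E)) (y : G ⧸ E) (t : G ⧸ E) hx
  exact mem_of_mem_DOver_of_commute hx hvE hv (hcomm.pow_right m)

instance ESeries_normal (h : Admissible m n G) (k : ℕ) : (ESeries h k).Normal :=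
  (ESeriesAux h k).2

theorem ESeries_succ_of_even (h : Admissible m n G) {k : ℕ} (hk : Even k) :
    ESeries h (k + 1) = EStep h (ESeries h k) := by
  simp only [ESeries, ESeriesAux, if_pos hk]

theorem ESeries_succ_of_not_even (h : Admissible m n G) {k : ℕ} (hk : ¬ Even k) :
    ESeries h (k + 1) = EStep h.symm (ESeries h k) := by
  simp only [ESeries, ESeriesAux, if_neg hk]

theorem le_EStep (h : Admissible m n G) (N : Subgroup G) [N.Normal] : N ≤ EStep h N := by
  unfold EStep
  split_ifs
  · exact le_top
  · exact le_DOver h N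

theorem ESeries_monotone (h : Admissible m n G) : Monotone (ESeries h) := by
  refine monotone_nat_of_le_succ fun k => ?_
  by_cases hk : Even k
  · rw [ESeries_succ_of_even h hk]
    exact le_EStep h _
  · rw [ESeries_succ_of_not_even h hk]
    exact le_EStep h.symm _

theorem ESeries_succ_eq_top (h : Admissible m n G) {k : ℕ}
    (hk : Group.IsNilpotent (G ⧸ ESeries h k)) : ESeries h (k + 1) = ⊤ := by
  by_cases hk' : Even k
  · rw [ESeries_succ_of_even h hk', EStep, if_pos hk]
  · rw [ESeries_succ_of_not_even h hk', EStep, if_pos hk]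

theorem ESeries_succ_of_not_isNilpotent (h : Admissible m n G) {k : ℕ} {N : Subgroup G} [N.Normal]
    (hN : ESeries h k = N) (hk : ¬ Group.IsNilpotent (G ⧸ ESeries h k)) :
    ESeries h (k + 1) = if Even k then DOver h N else DOver h.symm N := by
  subst hN
  split_ifs with hk'
  · rw [ESeries_succ_of_even h hk', EStep, if_neg hk]
  · rw [ESeries_succ_of_not_even h hk', EStep, if_neg hk]

theorem isNilpotent_quotient_of_le {N N' : Subgroup G} [N.Normal] [N'.Normal] (hle : N ≤ N')
    (hN : Group.IsNilpotent (G ⧸ N)) : Group.IsNilpotent (G ⧸ N') := by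
  refine Group.nilpotent_of_surjective (QuotientGroup.map N N' (MonoidHom.id G) hle) fun x => ?_
  obtain ⟨x, rfl⟩ := QuotientGroup.mk_surjective x
  exact ⟨(x : G ⧸ N), rfl⟩

/-- As long as no quotient is nilpotent, the `E`-series iterates `DOver`. Its third term is fixed by
both operators `DOver h` and `DOver h.symm`, so the series is constant from there on. -/
theorem ESeries_eq_of_three_le [Finite G] (h : Admissible m n G)
    (hnil : ¬ Group.IsNilpotent (G ⧸ ESeries h 3)) {k : ℕ} (hk : 3 ≤ k) :
    ESeries h k = ESeries h 3 := by
  have hnil' : ∀ j, ESeries h j ≤ ESeries h 3 → ¬ Group.IsNilpotent (G ⧸ ESeries h j) :=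
    fun j hj hjn => hnil (isNilpotent_quotient_of_le hj hjn)
  have h0 : ESeries h 0 = ⊥ := rfl
  have h1 := ESeries_succ_of_not_isNilpotent h h0 (hnil' 0 (ESeries_monotone h (by omega)))
  rw [if_pos (by decide)] at h1
  have h2 := ESeries_succ_of_not_isNilpotent h h1 (hnil' 1 (ESeries_monotone h (by omega)))
  rw [if_neg (by decide)] at h2
  have h3 := ESeries_succ_of_not_isNilpotent h h2 (hnil' 2 (ESeries_monotone h (by omega)))
  rw [if_pos (by decide)] at h3
  induction k, hk using Nat.le_induction with
  | base => rfl
  | succ k hk ih =>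
    rw [ESeries_succ_of_not_isNilpotent h (ih.trans h3) (hnil' k ih.le), h3]
    split_ifs
    · exact DOver_DOver h _
    · exact DOver_DOver_DOver_symm h _ (DOver_DOver h ⊥)

end CoprimeProducts

theorem theorem3p6 {G : Type*} [Group G] [Finite G] (m n : ℕ) (hm : 1 < m) (hn : 1 < n)
    (hmn : m.Coprime n) (hG : Nat.card G = m * n) :
    have h : CoprimeProducts.Admissible m n G := ⟨hmn, dvd_of_eq hG⟩
    let E₁ : Subgroup G := CoprimeProducts.D h
    let E₂ : Subgroup G := CoprimeProducts.DOver h.symm E₁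
    let E₃ : Subgroup G := CoprimeProducts.DOver h E₂
    let E₄ : Subgroup G := CoprimeProducts.DOver h.symm E₃
    E₃ = E₄ ∧ ∀ k : ℕ, 4 ≤ k → CoprimeProducts.ESeries h k = CoprimeProducts.ESeries h 4 := by
  intro h E₁ E₂ E₃ E₄
  refine ⟨?_, fun k hk => ?_⟩
  · refine (CoprimeProducts.DOver_DOver_DOver_symm h E₁ ?_).symm
    rw [← CoprimeProducts.DOver_congr h (CoprimeProducts.DOver_bot h),
      CoprimeProducts.DOver_DOver, CoprimeProducts.DOver_bot]
  · by_cases hnil : Group.IsNilpotent (G ⧸ CoprimeProducts.ESeries h 3)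
    · have h4 := CoprimeProducts.ESeries_succ_eq_top h hnil
      have hk4 := CoprimeProducts.ESeries_monotone h hk
      rw [h4] at hk4 ⊢
      exact top_le_iff.mp hk4
    · rw [CoprimeProducts.ESeries_eq_of_three_le h hnil (by omega),
        CoprimeProducts.ESeries_eq_of_three_le h hnil (by omega : 3 ≤ 4)]
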